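/- Let $n,m,d\in\{0,1,2,\dots\}$, $T>0$, $U\subset\mathbb R^d$, $g:\mathbb R^n\times\mathbb R^d\to\mathbb R^n$, $x_0\in\mathbb R^n$, $a_0\in\mathbb R^{mn}$, $b_0\in\mathbb R^m$. For $a=(a_1,\dots,a_m)\in\mathbb R^{mn}$ and $b\in\mathbb R^m$ put $C(a,b)=\{x\in\mathbb R^n:\langle a_i,x\rangle\le b_i,\ i=1,\dots,m\}$. Let $N(x;C)=\{v:\langle v,y-x\rangle\le 0\ \ \forall y\in C\}$ if $x\in C$ and $N(x;C)=\emptyset$ otherwise, and let $F(x,a,b,u)=N(x;C(a,b))-g(x,u)$. Let $\bar x\in W^{1,2}([0,T];\mathbb R^n)$, $\bar a\in W^{1,2}([0,T];\mathbb R^{mn})$, $\bar b\in W^{1,2}([0,T];\mathbb R^m)$, $\bar u\in L^2([0,T];\mathbb R^d)$ be a feasible solution of the controlled sweeping process, that is, $(\bar x,\bar a,\bar b)(0)=(x_0,a_0,b_0)$, and $$-\dot{\bar x}(t)\in F(\bar x(t),\bar a(t),\bar b(t),\bar u(t)),\quad \bar u(t)\in U\quad\text{for a.e. }t\in[0,T],$$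 $$\|\bar a_i(t)\|=1,\quad \langle\bar a_i(t),\bar x(t)\rangle\le\bar b_i(t)\quad\text{for all }t\in[0,T],\ i=1,\dots,m.$$ Assume the following. (H1) $U$ is closed and bounded. (H2) $\dot{\bar a}_i,\dot{\bar b}_i$ ($i=1,\dots,m$) are essentially bounded on $[0,T]$. (H3) There are $L,M>0$ with $\|g(x_1,u_1)-g(x_2,u_2)\|\le L(\|x_1-x_2\|+\|u_1-u_2\|)$ for all $(x_1,u_1),(x_2,u_2)\in\mathbb R^n\times U$ and $\|g(x,u)\|\le M(1+\|x\|)$ for all $(x,u)\in\mathbb R^n\times U$. (H4) There are $v_i\in W^{1,2}([0,T];\mathbb R)$ with $\|\bar a_i(t)-\bar a_i(s)\|\le|v_i(t)-v_i(s)|$ for all $s,t\in[0,T]$ and $i=1,\dots,m$, and there is a continuous $\vartheta:[0,T]\to\mathbb R$ with $\sup_{[0,T]}\vartheta<0$ such that for every $t\in[0,T]$ some $y\in\mathbb R^n$ satisfies $\langle\bar a_i(t),y\rangle-\bar b_i(t)<\vartheta(t)$ for $i=1,\dots,m$. Assume also that $\dot{\bar x},\dot{\bar a},\dot{\bar b},\bar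 u$ are of bounded variation on $[0,T]$ (that is, have representatives of bounded variation). Then there are a constant $\tilde\nu>0$, partitions $\Delta_k=\{0=t^k_0<t^k_1<\dots<t^k_{\nu(k)}=T\}$ with $\nu(k)\ge k$ and $t^k_{j+1}-t^k_j\le\tilde\nu/\nu(k)$ for $j=0,\dots,\nu(k)-1$, numbers $\delta_k>0$ with $\delta_k\to0$, continuous functions $x^k,a^k,b^k$ on $[0,T]$ that are affine on each $[t^k_j,t^k_{j+1}]$, and functions $u^k:[0,T]\to U$ that are constant on each $[t^k_j,t^k_{j+1})$, such that for all $k\in\mathbb N$ one has $(x^k(0),a^k(0),b^k(0))=(x_0,a_0,b_0)$, $$1-\delta_k\le\|a^k_i(t^k_j)\|\le1+\delta_k,\qquad j=0,\dots,\nu(k),\ i=1,\dots,m,$$ $$x^k(t)=x^k(t^k_j)+(t-t^k_j)v^k_j\ \text{ for } t\in[t^k_j,t^k_{j+1}],\quad\text{with } -v^k_j\in F\big(x^k(t^k_j),a^k(t^k_j),b^k(t^k_j),u^k(t^k_j)\big),\qquad j=0,\dots,\nu(k)-1,$$ and such that, as $k\to\infty$, $(x^k,a^k,b^k)\to(\bar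 x,\bar a,\bar b)$ in the norm topology of $W^{1,2}([0,T])$ and $u^k\to\bar u$ in the norm topology of $L^2([0,T];\mathbb R^d)$. -/

import Mathlib

open MeasureTheory Set Filter
open scoped Topology

noncomputable section

/-- The space `ℝⁿ` with its Euclidean norm. -/
abbrev RSpace (n : ℕ) : Type := EuclideanSpace ℝ (Fin n)

/-- The space `ℝ^{mn}` of families `(a₁, …, a_m)` of vectors of `ℝⁿ`, with its Euclidean norm. -/
abbrev RFamily (m n : ℕ) : Type := PiLp 2 (fun _ : Fin m => RSpace n)

/-- The restriction of Lebesgue measure to `[0,T]`. -/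
abbrev timeMeasure (T : ℝ) : Measure ℝ := volume.restrict (Icc 0 T)

section Sobolev

variable {E : Type*} [NormedAddCommGroup E] [NormedSpace ℝ E]

/-- `w` is (a representative of) the derivative of the `W^{1,2}` arc `f` on `[0,T]`:
`w` is square integrable on `[0,T]` and `f` is an indefinite integral of `w` there. -/
def IsArcDeriv (T : ℝ) (f w : ℝ → E) : Prop :=
  MemLp w 2 (timeMeasure T) ∧ ∀ t ∈ Icc 0 T, f t = f 0 + ∫ s in (0 : ℝ)..t, w s

/-- `f ∈ W^{1,2}([0,T]; E)`. -/
def MemW12 (T : ℝ) (f : ℝ → E) : Prop :=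
  ∃ w : ℝ → E, IsArcDeriv T f w

/-- `f ∈ W^{1,2}([0,T]; E)` and its derivative, which is determined up to null sets, is of
bounded variation on `[0,T]` (that is, has a representative of bounded variation). -/
def HasBVDeriv (T : ℝ) (f : ℝ → E) : Prop :=
  ∃ w : ℝ → E, IsArcDeriv T f w ∧ BoundedVariationOn w (Icc 0 T)

/-- Convergence in the norm topology of `L²([0,T]; E)`. -/
def TendstoL2 (T : ℝ) (F : ℕ → ℝ → E) (f : ℝ → E) : Prop :=
  (∀ k, MemLp (F k) 2 (timeMeasure T)) ∧ MemLp f 2 (timeMeasure T) ∧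
    Tendsto (fun k => eLpNorm (fun t => F k t - f t) 2 (timeMeasure T)) atTop (𝓝 0)

/-- Convergence in the norm topology of `W^{1,2}([0,T]; E)`: the functions and their derivatives
converge in `L²`. -/
def TendstoW12 (T : ℝ) (F : ℕ → ℝ → E) (f : ℝ → E) : Prop :=
  ∃ (W : ℕ → ℝ → E) (w : ℝ → E),
    (∀ k, IsArcDeriv T (F k) (W k)) ∧ IsArcDeriv T f w ∧ TendstoL2 T F f ∧ TendstoL2 T W w

/-- `0 = t₀ < t₁ < ⋯ < t_N = T`. Only the values `t j` with `j ≤ N` matter. -/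
structure IsPartition (T : ℝ) (N : ℕ) (t : ℕ → ℝ) : Prop where
  left : t 0 = 0
  right : t N = T
  lt : ∀ j < N, t j < t (j + 1)

/-- `f` is affine on each closed mesh interval `[t_j, t_{j+1}]`, `j < N`. -/
def IsPiecewiseLinear (N : ℕ) (t : ℕ → ℝ) (f : ℝ → E) : Prop :=
  ∀ j < N, ∀ s ∈ Icc (t j) (t (j + 1)),
    f s = f (t j) + ((s - t j) / (t (j + 1) - t j)) • (f (t (j + 1)) - f (t j))

/-- `f` is constant on each mesh interval `[t_j, t_{j+1})`, `j < N`. -/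
def IsPiecewiseConstant (N : ℕ) (t : ℕ → ℝ) (f : ℝ → E) : Prop :=
  ∀ j < N, ∀ s ∈ Ico (t j) (t (j + 1)), f s = f (t j)

end Sobolev

section Sweeping

variable {n m d : ℕ}

/-- The normal cone of convex analysis, empty at points outside of the set. -/
def normalCone (C : Set (RSpace n)) (x : RSpace n) : Set (RSpace n) :=
  {v | x ∈ C ∧ ∀ y ∈ C, inner ℝ v (y - x) ≤ 0}

/-- The polyhedron `C(a,b) = {x : ⟨aᵢ, x⟩ ≤ bᵢ, i = 1, …, m}`. -/
def polyhedron (a : RFamily m n) (b : RSpace m) : Set (RSpace n) :=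
  {x | ∀ i, inner ℝ (a i) x ≤ b i}

/-- The sweeping velocity mapping `F(x,a,b,u) = N(x; C(a,b)) - g(x,u)`. -/
def velocityMap (g : RSpace n → RSpace d → RSpace n)
    (x : RSpace n) (a : RFamily m n) (b : RSpace m) (u : RSpace d) : Set (RSpace n) :=
  (fun v => v - g x u) '' normalCone (polyhedron a b) x

/-- Feasible quadruples of the controlled sweeping process on `[0,T]` with control set `U`,
perturbation `g` and initial data `x₀, a₀, b₀`. -/
structure IsFeasible (T : ℝ) (U : Set (RSpace d)) (g : RSpace n → RSpace d → RSpace n)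
    (x₀ : RSpace n) (a₀ : RFamily m n) (b₀ : RSpace m)
    (x : ℝ → RSpace n) (a : ℝ → RFamily m n) (b : ℝ → RSpace m) (u : ℝ → RSpace d) : Prop where
  a_mem : MemW12 T a
  b_mem : MemW12 T b
  u_mem : MemLp u 2 (timeMeasure T)
  x_init : x 0 = x₀
  a_init : a 0 = a₀
  b_init : b 0 = b₀
  /-- `x ∈ W^{1,2}` and `-ẋ(t) ∈ F(x(t), a(t), b(t), u(t))` for almost every `t ∈ [0,T]`. -/
  inclusion : ∃ w : ℝ → RSpace n, IsArcDeriv T x w ∧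
    ∀ᵐ t ∂(timeMeasure T), -w t ∈ velocityMap g (x t) (a t) (b t) (u t)
  u_constraint : ∀ᵐ t ∂(timeMeasure T), u t ∈ U
  a_norm : ∀ t ∈ Icc 0 T, ∀ i, ‖a t i‖ = 1
  state_constraint : ∀ t ∈ Icc 0 T, x t ∈ polyhedron (a t) (b t)

/-- The derivatives of `aᵢ` and `bᵢ` are essentially uniformly bounded on `[0,T]`. -/
def BoundedDerivs (T : ℝ) (a : ℝ → RFamily m n) (b : ℝ → RSpace m) : Prop :=
  ∃ (a' : ℝ → RFamily m n) (b' : ℝ → RSpace m) (R : ℝ), IsArcDeriv T a a' ∧ IsArcDeriv T b b' ∧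
    ∀ᵐ t ∂(timeMeasure T), ∀ i, ‖a' t i‖ ≤ R ∧ |b' t i| ≤ R

/-- `g` is Lipschitz continuous on `ℝⁿ × U` and of sublinear growth in `x`, uniformly in
`u ∈ U`. -/
def RegularPerturbation (U : Set (RSpace d)) (g : RSpace n → RSpace d → RSpace n) : Prop :=
  (∃ L > 0, ∀ x₁ x₂ : RSpace n, ∀ u₁ ∈ U, ∀ u₂ ∈ U,
    ‖g x₁ u₁ - g x₂ u₂‖ ≤ L * (‖x₁ - x₂‖ + ‖u₁ - u₂‖)) ∧
  (∃ M > 0, ∀ x : RSpace n, ∀ u ∈ U, ‖g x u‖ ≤ M * (1 + ‖x‖))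

/-- The increments of each `aᵢ` are dominated by those of a scalar `W^{1,2}` function. -/
def DominatedIncrements (T : ℝ) (a : ℝ → RFamily m n) : Prop :=
  ∃ v : Fin m → ℝ → ℝ, (∀ i, MemW12 T (v i)) ∧
    ∀ i, ∀ s ∈ Icc 0 T, ∀ t ∈ Icc 0 T, ‖a t i - a s i‖ ≤ |v i t - v i s|

/-- The uniform Slater condition: for some continuous `ϑ` on `[0,T]` with negative supremum, the
system `⟨aᵢ(t), y⟩ - bᵢ(t) < ϑ(t)`, `i = 1, …, m`, is solvable for every `t ∈ [0,T]`. -/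
def UniformSlater (T : ℝ) (a : ℝ → RFamily m n) (b : ℝ → RSpace m) : Prop :=
  ∃ ϑ : ℝ → ℝ, ContinuousOn ϑ (Icc 0 T) ∧ (∃ c < 0, ∀ t ∈ Icc 0 T, ϑ t ≤ c) ∧
    ∀ t ∈ Icc 0 T, ∃ y : RSpace n, ∀ i, inner ℝ (a t i) y - b t i < ϑ t

end Sweeping

end

/-! The idea is to keep the normal vectors of the reference process and move the polyhedra. A
derivative of bounded variation is bounded and continuous at almost every point, so it can be
sampled at mesh points, and these can be taken in the full-measure set of times where the inclusion
and the control constraint hold. With `w` the derivative of `x`, the vector `p = g(x,u) - w` is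
normal at such a time. The scheme with velocity `g(y,u) - g(x(t_j),u) + w(t_j)` at the discrete
state `y` uses exactly this `p`.

For `p` to be normal at `y`, the polyhedron is translated by `y - x(t_j)`. This keeps `a(t_j)` and
adds `⟨aᵢ(t_j), y - x(t_j)⟩` to `bᵢ(t_j)` (`velocityMap_translate`). So `aᵏ` interpolates `a`, and
all corrections go into `bᵏ`.

Discrete Gronwall bounds the state error at the mesh points by the `L¹` error of sampling `w`
(`IsPartition.norm_discreteState_sub_le`), which tends to zero. The slopes of the states then
converge boundedly almost everywhere to `w`. A discrete product rule shows that the correction of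
`bᵏ` has slopes tending to zero, and dominated convergence gives the `W^{1,2}` limits
(`IsMeshSeq.tendstoW12_discreteState`). -/

noncomputable section

/-! ### Arcs with bounded derivative and dominated convergence. -/

section Arcs

variable {E : Type*} [NormedAddCommGroup E] {T : ℝ}

theorem tendstoL2_of_dominated {F : ℕ → ℝ → E} {f : ℝ → E} {R : ℝ}
    (hF : ∀ k, AEStronglyMeasurable (F k) (timeMeasure T))
    (hR : ∀ k, ∀ᵐ t ∂(timeMeasure T), ‖F k t‖ ≤ R)
    (hlim : ∀ᵐ t ∂(timeMeasure T), Tendsto (fun k => F k t) atTop (𝓝 (f t))) :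
    TendstoL2 T F f := by
  have hf : AEStronglyMeasurable f (timeMeasure T) := aestronglyMeasurable_of_tendsto_ae _ hF hlim
  have hfR : ∀ᵐ t ∂(timeMeasure T), ‖f t‖ ≤ R := by
    filter_upwards [hlim, ae_all_iff.2 hR] with t ht hRt
    exact le_of_tendsto ht.norm (Eventually.of_forall hRt)
  refine ⟨fun k => MemLp.of_bound (hF k) R (hR k), MemLp.of_bound hf R hfR, ?_⟩
  refine tendsto_Lp_finite_of_tendsto_ae (by norm_num) (by norm_num) hF
    (MemLp.of_bound hf R hfR) ?_ hlim
  refine unifIntegrable_of (by norm_num) (by norm_num) hF fun ε _ => ?_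
  -- Truncation above the common bound leaves nothing, which makes uniform integrability trivial.
  refine ⟨(R + 1).toNNReal, fun k => ?_⟩
  have h0 : {t | (R + 1).toNNReal ≤ ‖F k t‖₊}.indicator (F k) =ᵐ[timeMeasure T] 0 := by
    filter_upwards [hR k] with t ht
    refine indicator_of_notMem (fun hmem => ?_) _
    have h1 : R + 1 ≤ ‖F k t‖ := Real.toNNReal_le_iff_le_coe.1 hmem
    linarith
  rw [eLpNorm_congr_ae h0]
  simp

theorem intervalIntegrable_of_bounded {w : ℝ → E} (hw : StronglyMeasurable w) {R : ℝ}
    (hR : ∀ t, ‖w t‖ ≤ R) (p q : ℝ) : IntervalIntegrable w volume p q := by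
  rw [intervalIntegrable_iff]
  exact Measure.integrableOn_of_bounded (by simp) hw.aestronglyMeasurable
    (Eventually.of_forall hR)

theorem tendsto_integral_norm_sub_of_dominated (hT : 0 ≤ T) {W : ℕ → ℝ → E} {w : ℝ → E} {R : ℝ}
    (hw : AEStronglyMeasurable w (timeMeasure T)) (hwR : ∀ t ∈ Icc 0 T, ‖w t‖ ≤ R)
    (hW : ∀ k, StronglyMeasurable (W k)) (hR : ∀ k t, ‖W k t‖ ≤ R)
    (hlim : ∀ᵐ t ∂(timeMeasure T), Tendsto (fun k => W k t) atTop (𝓝 (w t))) :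
    Tendsto (fun k => ∫ s in (0 : ℝ)..T, ‖W k s - w s‖) atTop (𝓝 0) := by
  have h := intervalIntegral.tendsto_integral_filter_of_dominated_convergence (μ := volume)
    (a := 0) (b := T) (l := atTop) (F := fun k s => ‖W k s - w s‖) (f := fun _ => (0 : ℝ))
    (fun _ => R + R) ?_ ?_ intervalIntegrable_const ?_
  · simpa using h
  · refine Eventually.of_forall fun k => ?_
    have h1 : AEStronglyMeasurable w (volume.restrict (uIoc 0 T)) :=
      hw.mono_measure (Measure.restrict_mono
        (by rw [uIoc_of_le hT]; exact Ioc_subset_Icc_self) le_rfl)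
    exact ((hW k).aestronglyMeasurable.sub h1).norm
  · refine Eventually.of_forall fun k => Eventually.of_forall fun s hs => ?_
    rw [uIoc_of_le hT] at hs
    rw [norm_norm]
    exact (norm_sub_le _ _).trans (add_le_add (hR k s) (hwR s (Ioc_subset_Icc_self hs)))
  · rw [ae_restrict_iff' measurableSet_Icc] at hlim
    filter_upwards [hlim] with s hs hst
    rw [uIoc_of_le hT] at hst
    have := (hs (Ioc_subset_Icc_self hst)).sub_const (w s)
    simpa using this.norm

variable [NormedSpace ℝ E]

theorem isArcDeriv_primitive {w : ℝ → E} (hw : StronglyMeasurable w) {R : ℝ}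
    (hR : ∀ t, ‖w t‖ ≤ R) (y : E) :
    IsArcDeriv T (fun t => y + ∫ s in (0 : ℝ)..t, w s) w :=
  ⟨MemLp.of_bound hw.aestronglyMeasurable R (Eventually.of_forall hR), fun t _ => by simp⟩

theorem IsArcDeriv.intervalIntegrable {f w : ℝ → E} (h : IsArcDeriv T f w) {p q : ℝ}
    (hp : p ∈ Icc 0 T) (hq : q ∈ Icc 0 T) : IntervalIntegrable w volume p q := by
  have h1 : IntegrableOn w (Icc 0 T) := h.1.integrable (by norm_num)
  exact (h1.mono_set (ordConnected_Icc.uIcc_subset hp hq)).intervalIntegrable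

theorem IsArcDeriv.integral_eq {f w : ℝ → E} (h : IsArcDeriv T f w) {p q : ℝ}
    (hp : p ∈ Icc 0 T) (hq : q ∈ Icc 0 T) : ∫ s in p..q, w s = f q - f p := by
  have h0 : (0 : ℝ) ∈ Icc 0 T := ⟨le_rfl, hp.1.trans hp.2⟩
  rw [h.2 p hp, h.2 q hq, ← intervalIntegral.integral_interval_sub_left
    (h.intervalIntegrable h0 hq) (h.intervalIntegrable h0 hp)]
  abel

/-- By Lebesgue differentiation, either function is the pointwise derivative of `f` almost
everywhere. This allows passing between the derivative in the inclusion and the one of bounded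
variation. -/
theorem IsArcDeriv.ae_eq [CompleteSpace E] {f w w' : ℝ → E} (hT : 0 < T)
    (h : IsArcDeriv T f w) (h' : IsArcDeriv T f w') : ∀ᵐ t ∂(timeMeasure T), w t = w' t := by
  have h0 : (0 : ℝ) ∈ Icc 0 T := ⟨le_rfl, hT.le⟩
  have hTm : T ∈ Icc 0 T := ⟨hT.le, le_rfl⟩
  have key : ∀ {v : ℝ → E}, IsArcDeriv T f v →
      ∀ᵐ t ∂(volume.restrict (Ioo 0 T)), HasDerivAt f (v t) t := by
    intro v hv
    rw [ae_restrict_iff' measurableSet_Ioo]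
    filter_upwards [(hv.intervalIntegrable h0 hTm).ae_hasDerivAt_integral] with t ht htm
    rw [uIcc_of_le hT.le] at ht
    have h1 := (ht (Ioo_subset_Icc_self htm) 0 h0).const_add (f 0)
    refine h1.congr_of_eventuallyEq ?_
    filter_upwards [Ioo_mem_nhds htm.1 htm.2] with s hs
    exact hv.2 s (Ioo_subset_Icc_self hs)
  rw [timeMeasure, ← restrict_Ioo_eq_restrict_Icc]
  filter_upwards [key h, key h'] with t h1 h2
  exact h1.unique h2

theorem IsArcDeriv.congr_ae {f w w' : ℝ → E} (h : IsArcDeriv T f w)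
    (hw : ∀ᵐ t ∂(timeMeasure T), w t = w' t) : IsArcDeriv T f w' := by
  refine ⟨h.1.ae_eq hw, fun t ht => ?_⟩
  rw [h.2 t ht]
  congr 1
  refine intervalIntegral.integral_congr_ae ?_
  rw [ae_restrict_iff' measurableSet_Icc] at hw
  filter_upwards [hw] with s hs hst
  rw [uIoc_of_le ht.1] at hst
  exact hs ⟨hst.1.le, hst.2.trans ht.2⟩

theorem IsArcDeriv.norm_sub_le {f w : ℝ → E} (h : IsArcDeriv T f w) {R : ℝ}
    (hR : ∀ t ∈ Icc 0 T, ‖w t‖ ≤ R) {p q : ℝ} (hp : p ∈ Icc 0 T) (hq : q ∈ Icc 0 T) :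
    ‖f q - f p‖ ≤ R * |q - p| := by
  rw [← h.integral_eq hp hq]
  exact intervalIntegral.norm_integral_le_of_norm_le_const fun s hs =>
    hR s (ordConnected_Icc.uIcc_subset hp hq (uIoc_subset_uIcc hs))

/-- An arc is bounded when its derivative is. -/
theorem IsArcDeriv.norm_le {f w : ℝ → E} (h : IsArcDeriv T f w) {R : ℝ} (hT : 0 ≤ T)
    (hR : ∀ t ∈ Icc 0 T, ‖w t‖ ≤ R) : ∀ t ∈ Icc 0 T, ‖f t‖ ≤ ‖f 0‖ + R * T := by
  intro t ht
  have hR0 : 0 ≤ R := (norm_nonneg _).trans (hR t ht)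
  have h1 := h.norm_sub_le hR ⟨le_rfl, hT⟩ ht
  have h2 : R * |t - 0| ≤ R * T := by
    rw [sub_zero, abs_of_nonneg ht.1]
    exact mul_le_mul_of_nonneg_left ht.2 hR0
  have h3 : ‖f t‖ ≤ ‖f 0‖ + ‖f t - f 0‖ := by
    simpa using norm_add_le (f 0) (f t - f 0)
  linarith

/-- Dominated almost everywhere convergence of the derivatives implies convergence of the arcs in
`W^{1,2}`. -/
theorem tendstoW12_of_dominated (hT : 0 ≤ T) {W : ℕ → ℝ → E} {f w : ℝ → E} {R : ℝ}
    (hf : IsArcDeriv T f w) (hW : ∀ k, StronglyMeasurable (W k)) (hR : ∀ k t, ‖W k t‖ ≤ R)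
    (hlim : ∀ᵐ t ∂(timeMeasure T), Tendsto (fun k => W k t) atTop (𝓝 (w t))) :
    TendstoW12 T (fun k t => f 0 + ∫ s in (0 : ℝ)..t, W k s) f := by
  have hprim : ∀ k, IsArcDeriv T (fun t => f 0 + ∫ s in (0 : ℝ)..t, W k s) (W k) :=
    fun k => isArcDeriv_primitive (hW k) (hR k) _
  refine ⟨W, w, hprim, hf, ?_, tendstoL2_of_dominated (fun k => (hW k).aestronglyMeasurable)
    (fun k => Eventually.of_forall (hR k)) hlim⟩
  refine tendstoL2_of_dominated (R := ‖f 0‖ + R * T) (fun k => ?_) (fun k => ?_) ?_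
  · have hc : Continuous fun t => f 0 + ∫ s in (0 : ℝ)..t, W k s :=
      continuous_const.add (intervalIntegral.continuous_primitive
        (intervalIntegrable_of_bounded (hW k) (hR k)) 0)
    exact hc.aestronglyMeasurable
  · filter_upwards [ae_restrict_mem measurableSet_Icc] with t ht
    simpa using (hprim k).norm_le hT (fun s _ => hR k s) t ht
  · filter_upwards [ae_restrict_mem measurableSet_Icc] with t ht
    rw [hf.2 t ht]
    refine tendsto_const_nhds.add
      (intervalIntegral.tendsto_integral_filter_of_dominated_convergence (fun _ => R)
        (Eventually.of_forall fun k => (hW k).aestronglyMeasurable)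
        (Eventually.of_forall fun k => Eventually.of_forall fun s _ => hR k s)
        intervalIntegrable_const ?_)
    rw [ae_restrict_iff' measurableSet_Icc] at hlim
    filter_upwards [hlim] with s hs hst
    rw [uIoc_of_le ht.1] at hst
    exact hs ⟨hst.1.le, hst.2.trans ht.2⟩

end Arcs

/-! ### Bounded variation implies Riemann integrability. -/

section BoundedVariation

variable {E : Type*} [NormedAddCommGroup E] {T : ℝ}

/-- `w` is bounded on `[0,T]` and continuous at almost every point of `[0,T]`, that is,
Riemann integrable there. -/
def IsRiemann (T : ℝ) (w : ℝ → E) : Prop :=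
  (∃ R, ∀ t ∈ Icc 0 T, ‖w t‖ ≤ R) ∧
    ∀ᵐ t ∂(timeMeasure T), ContinuousWithinAt w (Icc 0 T) t

/-- The total variation bounds the distance to `w 0`, and functions of bounded variation are
differentiable almost everywhere. -/
theorem BoundedVariationOn.isRiemann [NormedSpace ℝ E] [FiniteDimensional ℝ E] {w : ℝ → E}
    (hT : 0 ≤ T) (hw : BoundedVariationOn w (Icc 0 T)) : IsRiemann T w := by
  refine ⟨⟨‖w 0‖ + (eVariationOn w (Icc 0 T)).toReal, fun t ht => ?_⟩, ?_⟩
  · have h1 := hw.dist_le ht (show (0 : ℝ) ∈ Icc 0 T from ⟨le_rfl, hT⟩)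
    rw [dist_eq_norm] at h1
    have h3 : ‖w t‖ ≤ ‖w 0‖ + ‖w t - w 0‖ := by simpa using norm_add_le (w 0) (w t - w 0)
    linarith
  · filter_upwards [hw.locallyBoundedVariationOn.ae_differentiableWithinAt measurableSet_Icc]
      with t ht
    exact ht.continuousWithinAt

theorem ae_ne_zero (T : ℝ) : ∀ᵐ t ∂(timeMeasure T), t ≠ 0 :=
  ae_restrict_of_ae (Measure.ae_ne volume 0)

/-- Time `0` must be a mesh point but need not be a good time; this permits prescribing the
derivative and the control there. -/
theorem IsRiemann.update {w : ℝ → E} (hw : IsRiemann T w) (y : E) :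
    IsRiemann T (Function.update w 0 y) := by
  obtain ⟨⟨R, hR⟩, hc⟩ := hw
  refine ⟨⟨max R ‖y‖, fun t ht => ?_⟩, ?_⟩
  · by_cases h : t = 0
    · subst h; simp
    · rw [Function.update_of_ne h]
      exact (hR t ht).trans (le_max_left _ _)
  · filter_upwards [hc, ae_ne_zero T] with t ht h0
    exact (continuousWithinAt_update_of_ne h0).2 ht

end BoundedVariation

/-! ### Partitions, step functions and polygons. -/

section Mesh

variable {E : Type*} [NormedAddCommGroup E] {T : ℝ} {N : ℕ} {t : ℕ → ℝ}

theorem IsPartition.mono (h : IsPartition T N t) {i j : ℕ} (hij : i ≤ j) (hj : j ≤ N) :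
    t i ≤ t j := by
  induction j, hij using Nat.le_induction with
  | base => exact le_rfl
  | succ j _ ih => exact (ih (by omega)).trans (h.lt j (by omega)).le

theorem IsPartition.mem_Icc (h : IsPartition T N t) {j : ℕ} (hj : j ≤ N) : t j ∈ Icc 0 T := by
  rw [← h.left, ← h.right]
  exact ⟨h.mono (Nat.zero_le j) hj, h.mono hj le_rfl⟩

theorem IsPartition.Icc_subset (h : IsPartition T N t) {j : ℕ} (hj : j < N) :
    Icc (t j) (t (j + 1)) ⊆ Icc 0 T :=
  Icc_subset_Icc (h.mem_Icc hj.le).1 (h.mem_Icc hj).2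

/-- The index of the mesh interval `[t_j, t_{j+1})` that contains `s`. -/
def meshIndex (N : ℕ) (t : ℕ → ℝ) (s : ℝ) : ℕ :=
  Nat.findGreatest (fun j => t j ≤ s) (N - 1)

/-- No restriction on `s` is needed: the search is capped at `N - 1` and returns `0` for times
before the mesh. Step functions are therefore bounded on the whole line. -/
theorem meshIndex_lt (hN : 0 < N) (s : ℝ) : meshIndex N t s < N := by
  have := Nat.findGreatest_le (P := fun j => t j ≤ s) (N - 1)
  unfold meshIndex
  omega

theorem measurable_meshIndex : Measurable (meshIndex N t) :=
  measurable_findGreatest fun _ _ => measurableSet_Ici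

theorem IsPartition.meshIndex_eq (h : IsPartition T N t) {j : ℕ} (hj : j < N) {s : ℝ}
    (hs : s ∈ Ico (t j) (t (j + 1))) : meshIndex N t s = j := by
  refine Nat.findGreatest_eq_iff.2 ⟨by omega, fun _ => hs.1, fun i hi hiN hle => ?_⟩
  have := h.mono (show j + 1 ≤ i by omega) (by omega)
  linarith [hs.2]

/-- The interval is closed on the right because `s = T` is assigned to the last mesh interval. -/
theorem IsPartition.mem_meshIndex (h : IsPartition T N t) (hN : 0 < N) {s : ℝ}
    (hs : s ∈ Icc 0 T) : s ∈ Icc (t (meshIndex N t s)) (t (meshIndex N t s + 1)) := by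
  refine ⟨?_, ?_⟩
  · have h0 : t 0 ≤ s := by rw [h.left]; exact hs.1
    exact Nat.findGreatest_spec (P := fun j => t j ≤ s) (Nat.zero_le _) h0
  · have hlt := meshIndex_lt (t := t) hN s
    by_contra! hcon
    rcases Nat.lt_or_ge (meshIndex N t s + 1) N with hlt' | hge
    · exact Nat.findGreatest_is_greatest (P := fun j => t j ≤ s) (n := N - 1)
        (k := meshIndex N t s + 1) (Nat.lt_succ_self _) (by omega) hcon.le
    · have : meshIndex N t s + 1 = N := by omega
      rw [this, h.right] at hcon
      linarith [hs.2]

/-- The step function with the values `c j` on the mesh intervals `[t_j, t_{j+1})`. -/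
def stepFun {X : Type*} (N : ℕ) (t : ℕ → ℝ) (c : ℕ → X) (s : ℝ) : X :=
  c (meshIndex N t s)

theorem stronglyMeasurable_stepFun (c : ℕ → E) : StronglyMeasurable (stepFun N t c) :=
  (StronglyMeasurable.of_discrete (f := c)).comp_measurable measurable_meshIndex

theorem norm_stepFun_le (hN : 0 < N) {c : ℕ → E} {R : ℝ} (hc : ∀ j < N, ‖c j‖ ≤ R) (s : ℝ) :
    ‖stepFun N t c s‖ ≤ R :=
  hc _ (meshIndex_lt hN s)

theorem exists_bound_stepFun (hN : 0 < N) (c : ℕ → E) : ∃ R, ∀ s, ‖stepFun N t c s‖ ≤ R := by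
  refine ⟨∑ j ∈ Finset.range N, ‖c j‖, fun s => norm_stepFun_le hN (fun j hj => ?_) s⟩
  exact Finset.single_le_sum (f := fun j => ‖c j‖) (fun _ _ => norm_nonneg _)
    (Finset.mem_range.2 hj)

theorem IsPartition.isPiecewiseConstant_stepFun {X : Type*} (h : IsPartition T N t)
    (c : ℕ → X) :
    IsPiecewiseConstant N t (stepFun N t c) := by
  intro j hj s hs
  rw [stepFun, stepFun, h.meshIndex_eq hj hs, h.meshIndex_eq hj ⟨le_rfl, h.lt j hj⟩]

variable [NormedSpace ℝ E]

theorem IsPartition.integral_stepFun [CompleteSpace E] (h : IsPartition T N t) {j : ℕ} (hj : j < N) (c : ℕ → E)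
    {s : ℝ} (hs : s ∈ Icc (t j) (t (j + 1))) :
    ∫ r in (t j)..s, stepFun N t c r = (s - t j) • c j := by
  rw [← intervalIntegral.integral_const]
  refine intervalIntegral.integral_congr_uIoo fun r hr => ?_
  rw [uIoo_of_le hs.1] at hr
  rw [stepFun, h.meshIndex_eq hj ⟨hr.1.le, hr.2.trans_le hs.2⟩]

/-- The difference quotients of `y` over the mesh intervals. -/
def meshSlope (t : ℕ → ℝ) (y : ℕ → E) (j : ℕ) : E :=
  (t (j + 1) - t j)⁻¹ • (y (j + 1) - y j)

/-- The continuous piecewise linear function with the value `y j` at `t_j`. -/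
def polygon (N : ℕ) (t : ℕ → ℝ) (y : ℕ → E) (s : ℝ) : E :=
  y 0 + ∫ r in (0 : ℝ)..s, stepFun N t (meshSlope t y) r

theorem polygon_zero (y : ℕ → E) : polygon N t y 0 = y 0 := by simp [polygon]

theorem IsPartition.polygon_mesh [CompleteSpace E] (h : IsPartition T N t) (y : ℕ → E) {j : ℕ} (hj : j ≤ N) :
    polygon N t y (t j) = y j := by
  induction j with
  | zero => rw [h.left, polygon_zero]
  | succ j ih =>
    obtain ⟨R, hR⟩ := exists_bound_stepFun (t := t) (show 0 < N by omega) (meshSlope t y)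
    have hint := intervalIntegrable_of_bounded (stronglyMeasurable_stepFun _) hR
    have hlt := h.lt j (by omega)
    have h1 := h.integral_stepFun (show j < N by omega) (meshSlope t y)
      (s := t (j + 1)) ⟨hlt.le, le_rfl⟩
    have h2 := ih (by omega)
    unfold polygon at h2 ⊢
    rw [← intervalIntegral.integral_add_adjacent_intervals (hint 0 (t j)) (hint (t j) _),
      ← add_assoc, h2, h1, meshSlope, smul_inv_smul₀ (sub_pos.2 hlt).ne']
    abel

theorem IsPartition.polygon_eq [CompleteSpace E] (h : IsPartition T N t) (y : ℕ → E) {j : ℕ}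
    (hj : j < N) {s : ℝ} (hs : s ∈ Icc (t j) (t (j + 1))) :
    polygon N t y s = polygon N t y (t j) + (s - t j) • meshSlope t y j := by
  obtain ⟨R, hR⟩ := exists_bound_stepFun (t := t) (show 0 < N by omega) (meshSlope t y)
  have hint := intervalIntegrable_of_bounded (stronglyMeasurable_stepFun _) hR
  unfold polygon
  rw [← h.integral_stepFun hj _ hs, add_assoc,
    intervalIntegral.integral_add_adjacent_intervals (hint _ _) (hint _ _)]

theorem IsPartition.isPiecewiseLinear_polygon [CompleteSpace E] (h : IsPartition T N t)
    (y : ℕ → E) :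
    IsPiecewiseLinear N t (polygon N t y) := by
  intro j hj s hs
  rw [h.polygon_eq y hj hs, h.polygon_mesh y hj.le, h.polygon_mesh y hj, meshSlope, smul_smul,
    div_eq_mul_inv]

/-- The step function of the difference quotients of an arc with bounded derivative is bounded. -/
theorem IsPartition.norm_meshSlope_le (h : IsPartition T N t) {f w : ℝ → E}
    (hf : IsArcDeriv T f w) {R : ℝ} (hR : ∀ s ∈ Icc 0 T, ‖w s‖ ≤ R) {j : ℕ} (hj : j < N) :
    ‖meshSlope t (fun i => f (t i)) j‖ ≤ R := by
  have hpos := sub_pos.2 (h.lt j hj)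
  have h1 := hf.norm_sub_le hR (h.mem_Icc hj.le) (h.mem_Icc hj)
  rw [abs_of_pos hpos] at h1
  rw [meshSlope, norm_smul, Real.norm_of_nonneg (inv_nonneg.2 hpos.le), inv_mul_le_iff₀ hpos]
  linarith

/-- A partition of `[0,T]` into `N` intervals of lengths at most `2T/N`, whose points, apart from
the end point `T`, belong to a prescribed set of full measure. -/
theorem exists_partition (hT : 0 < T) {G : Set ℝ} (hG : ∀ᵐ s ∂(timeMeasure T), s ∈ G)
    (h0 : (0 : ℝ) ∈ G) (hN : 0 < N) :
    ∃ t : ℕ → ℝ, IsPartition T N t ∧ (∀ j < N, t j ∈ G) ∧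
      ∀ j < N, t (j + 1) - t j ≤ 2 * T / N := by
  have hN' : (0 : ℝ) < N := by exact_mod_cast hN
  set h : ℝ := T / N with hh
  have hpos : 0 < h := div_pos hT hN'
  have hNh : N * h = T := by rw [hh]; field_simp
  -- The left half of each cell of length `h` has positive measure, so it meets `G`. Points chosen
  -- there are increasing, with gaps at most `3h/2`; the first is then replaced by `0`, and `T` is
  -- appended.
  have hex : ∀ j : ℕ, j < N → ∃ s ∈ Ioo (j * h) (j * h + h / 2), s ∈ G := by
    intro j hj
    by_contra! hcon
    have hsub : Ioo (j * h) (j * h + h / 2) ⊆ Icc 0 T := by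
      refine Ioo_subset_Icc_self.trans (Icc_subset_Icc (by positivity) ?_)
      have : ((j : ℝ) + 1) * h ≤ N * h :=
        mul_le_mul_of_nonneg_right (by exact_mod_cast hj) hpos.le
      linarith
    rw [ae_restrict_iff' measurableSet_Icc, ae_iff] at hG
    have h1 := measure_mono_null (s := Ioo (j * h) (j * h + h / 2))
      (fun s hs => by
        have hs1 := hsub hs
        have hs2 := hcon s hs
        exact fun hc => hs2 (hc hs1)) hG
    rw [Real.volume_Ioo, ENNReal.ofReal_eq_zero] at h1
    linarith
  choose! σ hσ hσG using hex
  refine ⟨fun j => if j = 0 then 0 else if j = N then T else σ j, ⟨by simp, by simp; omega, ?_⟩,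
    ?_, ?_⟩
  all_goals
    intro j hj
    have hjN : ((j : ℝ) + 1) * h ≤ N * h :=
      mul_le_mul_of_nonneg_right (by exact_mod_cast hj) hpos.le
  · have hs1 := hσ j hj
    have hs2 := hσ (j + 1)
    push_cast at hs2
    by_cases hj0 : j = 0
    · subst hj0
      by_cases h1 : 0 + 1 = N
      · simp only [if_true, h1, if_neg hN.ne', hT]
      · have := (hs2 (by omega)).1
        simp only [if_true, h1]
        norm_num at this ⊢
        linarith
    · by_cases h1 : j + 1 = N
      · simp only [hj0, hj.ne, h1, if_false, if_true, hN.ne']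
        linarith [hs1.2]
      · have := (hs2 (by omega)).1
        simp only [hj0, hj.ne, h1, if_false, Nat.add_eq_zero_iff, one_ne_zero, and_false]
        linarith [hs1.2]
  · by_cases hj0 : j = 0
    · simp [hj0, h0]
    · simp only [hj0, hj.ne, if_false]
      exact hσG j hj
  · have hs1 := hσ j hj
    have hs2 := hσ (j + 1)
    push_cast at hs2
    have h2h : 2 * T / N = 2 * h := by rw [hh]; ring
    rw [h2h]
    have hl : j * h ≤ if j = 0 then 0 else if j = N then T else σ j := by
      by_cases hj0 : j = 0
      · simp [hj0]
      · simp only [hj0, hj.ne, if_false]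
        exact hs1.1.le
    have hr : (if j + 1 = 0 then 0 else if j + 1 = N then T else σ (j + 1)) ≤
        (j + 1) * h + h / 2 := by
      rw [if_neg (by omega)]
      by_cases h1 : j + 1 = N
      · rw [if_pos h1, ← hNh, ← h1]
        push_cast
        linarith
      · rw [if_neg h1]
        exact (hs2 (by omega)).2.le
    linarith

end Mesh

/-! ### Limits of samples and difference quotients. -/

section MeshLimits

variable {E : Type*} [NormedAddCommGroup E] {T : ℝ} {N : ℕ → ℕ}
  {t : ℕ → ℕ → ℝ} {μ : ℕ → ℝ}

/-- A sequence of partitions of `[0,T]` whose mesh sizes tend to zero. -/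
structure IsMeshSeq (T : ℝ) (N : ℕ → ℕ) (t : ℕ → ℕ → ℝ) (μ : ℕ → ℝ) : Prop where
  pos : ∀ k, 0 < N k
  part : ∀ k, IsPartition T (N k) (t k)
  size : ∀ k, ∀ j < N k, t k (j + 1) - t k j ≤ μ k
  lim : Tendsto μ atTop (𝓝 0)

theorem IsMeshSeq.dist_le (h : IsMeshSeq T N t μ) (k : ℕ) {s r : ℝ} (hs : s ∈ Icc 0 T)
    (hr : r ∈ Icc (t k (meshIndex (N k) (t k) s)) (t k (meshIndex (N k) (t k) s + 1))) :
    dist r s ≤ μ k := by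
  have h1 := (h.part k).mem_meshIndex (h.pos k) hs
  have h2 := h.size k _ (meshIndex_lt (t := t k) (h.pos k) s)
  rw [Real.dist_eq, abs_le]
  constructor <;> linarith [h1.1, h1.2, hr.1, hr.2]

/-- Near a continuity point, the values of `w` on the mesh interval around it converge uniformly. -/
theorem IsMeshSeq.eventually_norm_sub_le (h : IsMeshSeq T N t μ) {w : ℝ → E} {s : ℝ}
    (hs : s ∈ Icc 0 T) (hw : ContinuousWithinAt w (Icc 0 T) s) {ε : ℝ} (hε : 0 < ε) :
    ∀ᶠ k in atTop,
      ∀ r ∈ Icc (t k (meshIndex (N k) (t k) s)) (t k (meshIndex (N k) (t k) s + 1)),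
        ‖w r - w s‖ ≤ ε := by
  obtain ⟨η, hη, hwη⟩ := Metric.continuousWithinAt_iff.1 hw ε hε
  filter_upwards [h.lim.eventually_lt_const hη] with k hk r hr
  rw [← dist_eq_norm]
  exact (hwη ((h.part k).Icc_subset (meshIndex_lt (h.pos k) s) hr)
    ((h.dist_le k hs hr).trans_lt hk)).le

theorem IsMeshSeq.tendsto_stepFun (h : IsMeshSeq T N t μ) {w : ℝ → E} {s : ℝ}
    (hs : s ∈ Icc 0 T) (hw : ContinuousWithinAt w (Icc 0 T) s) :
    Tendsto (fun k => stepFun (N k) (t k) (fun j => w (t k j)) s) atTop (𝓝 (w s)) := by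
  rw [Metric.tendsto_nhds]
  intro ε hε
  filter_upwards [h.eventually_norm_sub_le hs hw (half_pos hε)] with k hk
  rw [dist_eq_norm]
  refine (hk _ ⟨le_rfl, ?_⟩).trans_lt (by linarith)
  exact ((h.part k).lt _ (meshIndex_lt (h.pos k) s)).le

theorem IsMeshSeq.tendstoL2_stepFun (h : IsMeshSeq T N t μ) {w : ℝ → E} (hw : IsRiemann T w) :
    TendstoL2 T (fun k => stepFun (N k) (t k) fun j => w (t k j)) w := by
  obtain ⟨⟨R, hR⟩, hc⟩ := hw
  refine tendstoL2_of_dominated (R := R)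
    (fun k => (stronglyMeasurable_stepFun _).aestronglyMeasurable)
    (fun k => Eventually.of_forall (norm_stepFun_le (h.pos k) fun j hj => ?_)) ?_
  · exact hR _ ((h.part k).mem_Icc hj.le)
  · filter_upwards [hc, ae_restrict_mem measurableSet_Icc] with s hcs hs
    exact h.tendsto_stepFun hs hcs

variable [NormedSpace ℝ E]

/-- A difference quotient of `f` is the mean of `w` over a mesh interval shrinking to the continuity
point `s`. -/
theorem IsMeshSeq.tendsto_meshSlope [CompleteSpace E] (h : IsMeshSeq T N t μ) {f w : ℝ → E}
    (hf : IsArcDeriv T f w) {s : ℝ} (hs : s ∈ Icc 0 T)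
    (hw : ContinuousWithinAt w (Icc 0 T) s) :
    Tendsto (fun k => stepFun (N k) (t k) (meshSlope (t k) fun j => f (t k j)) s) atTop
      (𝓝 (w s)) := by
  rw [Metric.tendsto_nhds]
  intro ε hε
  filter_upwards [h.eventually_norm_sub_le hs hw (half_pos hε)] with k hk
  refine lt_of_le_of_lt ?_ (half_lt_self hε)
  rw [dist_eq_norm]
  unfold stepFun meshSlope
  set j := meshIndex (N k) (t k) s
  have hj : j < N k := meshIndex_lt (h.pos k) s
  have hlt := (h.part k).lt j hj
  have hpos := sub_pos.2 hlt
  have hp := (h.part k).mem_Icc hj.le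
  have hq := (h.part k).mem_Icc (show j + 1 ≤ N k from hj)
  have h1 : (t k (j + 1) - t k j)⁻¹ • (f (t k (j + 1)) - f (t k j)) - w s =
      (t k (j + 1) - t k j)⁻¹ • ∫ r in (t k j)..(t k (j + 1)), (w r - w s) := by
    rw [intervalIntegral.integral_sub (hf.intervalIntegrable hp hq) intervalIntegrable_const,
      hf.integral_eq hp hq, intervalIntegral.integral_const, smul_sub _ (_ - _) (_ • _),
      inv_smul_smul₀ hpos.ne']
  rw [h1, norm_smul, Real.norm_of_nonneg (inv_nonneg.2 hpos.le), inv_mul_le_iff₀ hpos]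
  have h2 := intervalIntegral.norm_integral_le_of_norm_le_const (f := fun r => w r - w s)
    (a := t k j) (b := t k (j + 1)) (C := ε / 2) (fun r hr => by
      rw [uIoc_of_le hlt.le] at hr
      exact hk r (Ioc_subset_Icc_self hr))
  rw [abs_of_pos hpos] at h2
  linarith

/-- Convergence of polygons in `W^{1,2}` from dominated pointwise convergence of their slopes. -/
theorem IsMeshSeq.tendstoW12_polygon (h : IsMeshSeq T N t μ) (hT : 0 ≤ T) {f w : ℝ → E}
    (hf : IsArcDeriv T f w) {y : ℕ → ℕ → E} (hy : ∀ k, y k 0 = f 0) {R : ℝ}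
    (hR : ∀ k, ∀ j < N k, ‖meshSlope (t k) (y k) j‖ ≤ R)
    (hlim : ∀ᵐ s ∂(timeMeasure T),
      Tendsto (fun k => stepFun (N k) (t k) (meshSlope (t k) (y k)) s) atTop (𝓝 (w s))) :
    TendstoW12 T (fun k => polygon (N k) (t k) (y k)) f := by
  have h1 := tendstoW12_of_dominated hT hf
    (W := fun k => stepFun (N k) (t k) (meshSlope (t k) (y k)))
    (fun k => stronglyMeasurable_stepFun _) (fun k s => norm_stepFun_le (h.pos k) (hR k) s) hlim
  have h2 : (fun k => polygon (N k) (t k) (y k)) = fun k s => f 0 +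
      ∫ r in (0 : ℝ)..s, stepFun (N k) (t k) (meshSlope (t k) (y k)) r := by
    funext k s
    rw [polygon, hy]
  rw [h2]
  exact h1

theorem IsMeshSeq.tendstoW12_interpolant [CompleteSpace E] (h : IsMeshSeq T N t μ) (hT : 0 ≤ T)
    {f w : ℝ → E} (hf : IsArcDeriv T f w) (hw : IsRiemann T w) :
    TendstoW12 T (fun k => polygon (N k) (t k) fun j => f (t k j)) f := by
  obtain ⟨⟨R, hR⟩, hc⟩ := hw
  refine h.tendstoW12_polygon hT hf (fun k => by rw [(h.part k).left])
    (fun k j hj => (h.part k).norm_meshSlope_le hf hR hj) ?_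
  filter_upwards [hc, ae_restrict_mem measurableSet_Icc] with s hcs hs
  exact h.tendsto_meshSlope hf hs hcs

end MeshLimits

/-! ### Translated polyhedra and the discrete process. -/

section Sweeping

variable {n m d : ℕ}

/-- The bilinear map `(a, x) ↦ (⟨a₁, x⟩, …, ⟨a_m, x⟩)`. -/
def rowPairing (a : RFamily m n) (x : RSpace n) : RSpace m :=
  WithLp.toLp 2 fun i => inner ℝ (a i) x

theorem rowPairing_apply (a : RFamily m n) (x : RSpace n) (i : Fin m) :
    rowPairing a x i = inner ℝ (a i) x := rfl

theorem norm_rowPairing_le (a : RFamily m n) (x : RSpace n) :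
    ‖rowPairing a x‖ ≤ ‖a‖ * ‖x‖ := by
  refine le_of_sq_le_sq ?_ (by positivity)
  rw [mul_pow, EuclideanSpace.norm_sq_eq, PiLp.norm_sq_eq_of_L2, Finset.sum_mul]
  refine Finset.sum_le_sum fun i _ => ?_
  rw [← mul_pow, rowPairing_apply]
  exact pow_le_pow_left₀ (norm_nonneg _) (norm_inner_le_norm _ _) 2

theorem rowPairing_sub_left (a a' : RFamily m n) (x : RSpace n) :
    rowPairing (a - a') x = rowPairing a x - rowPairing a' x := by
  ext i
  simp [rowPairing_apply, inner_sub_left]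

theorem rowPairing_sub_right (a : RFamily m n) (x x' : RSpace n) :
    rowPairing a (x - x') = rowPairing a x - rowPairing a x' := by
  ext i
  simp [rowPairing_apply, inner_sub_right]

theorem rowPairing_smul_left (r : ℝ) (a : RFamily m n) (x : RSpace n) :
    rowPairing (r • a) x = r • rowPairing a x := by
  ext i
  simp [rowPairing_apply, inner_smul_left]

theorem rowPairing_smul_right (r : ℝ) (a : RFamily m n) (x : RSpace n) :
    rowPairing a (r • x) = r • rowPairing a x := by
  ext i
  simp [rowPairing_apply, inner_smul_right]

/-- Discrete Leibniz rule: `α` is taken at the right end point and `e` at the left one, so no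
second-order term remains. -/
theorem meshSlope_rowPairing (t : ℕ → ℝ) (α : ℕ → RFamily m n) (β : ℕ → RSpace m)
    (e : ℕ → RSpace n) (j : ℕ) :
    meshSlope t (fun i => β i + rowPairing (α i) (e i)) j =
      meshSlope t β j + rowPairing (α (j + 1)) (meshSlope t e j) +
        rowPairing (meshSlope t α j) (e j) := by
  simp only [meshSlope, rowPairing_smul_left, rowPairing_smul_right, rowPairing_sub_left,
    rowPairing_sub_right, smul_sub, smul_add]
  abel

/-- Zero is a normal at every point of the set. -/
theorem neg_perturbation_mem_velocityMap {g : RSpace n → RSpace d → RSpace n} {x : RSpace n}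
    {a : RFamily m n} {b : RSpace m} {u : RSpace d} (hx : x ∈ polyhedron a b) :
    -g x u ∈ velocityMap g x a b u :=
  ⟨0, ⟨hx, by simp⟩, by simp⟩

/-- Translating the polyhedron together with the state does not change the normal cone. -/
theorem velocityMap_translate {g : RSpace n → RSpace d → RSpace n} {x w : RSpace n}
    {a : RFamily m n} {b : RSpace m} {u : RSpace d} (h : -w ∈ velocityMap g x a b u)
    (y : RSpace n) :
    -(g y u - g x u + w) ∈ velocityMap g y a (b + rowPairing a (y - x)) u := by
  obtain ⟨p, ⟨hx, hp⟩, hpw⟩ := h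
  refine ⟨p, ⟨fun i => ?_, fun z hz => ?_⟩, ?_⟩
  · have := hx i
    rw [PiLp.add_apply, rowPairing_apply, inner_sub_right]
    linarith
  -- A test point of the translated polyhedron is moved back into the original one.
  · have h1 := hp (z - (y - x)) fun i => by
      have := hz i
      rw [PiLp.add_apply, rowPairing_apply] at this
      rw [inner_sub_right]
      linarith
    rwa [show z - (y - x) - x = z - y by abel] at h1
  · have hpw' : p - g x u = -w := hpw
    change p - g y u = _
    rw [sub_eq_iff_eq_add] at hpw'
    rw [hpw']
    abel

/-- The states at the mesh points of the discrete sweeping process that uses the normal vectors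
`g(x,u) - w` of the reference process. -/
def discreteState (g : RSpace n → RSpace d → RSpace n) (t : ℕ → ℝ) (x w : ℝ → RSpace n)
    (u : ℝ → RSpace d) : ℕ → RSpace n
  | 0 => x 0
  | j + 1 => discreteState g t x w u j + (t (j + 1) - t j) •
      (g (discreteState g t x w u j) (u (t j)) - g (x (t j)) (u (t j)) + w (t j))

variable {T : ℝ} {N : ℕ} {t : ℕ → ℝ} {U : Set (RSpace d)} {g : RSpace n → RSpace d → RSpace n}
  {x w : ℝ → RSpace n} {u : ℝ → RSpace d}

theorem IsPartition.meshSlope_discreteState (h : IsPartition T N t) {j : ℕ} (hj : j < N) :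
    meshSlope t (discreteState g t x w u) j =
      g (discreteState g t x w u j) (u (t j)) - g (x (t j)) (u (t j)) + w (t j) := by
  rw [meshSlope, discreteState, add_sub_cancel_left, inv_smul_smul₀ (sub_pos.2 (h.lt j hj)).ne']

/-- The discrete Gronwall estimate for the distance of the discrete states to the reference
trajectory. -/
theorem IsPartition.norm_discreteState_sub_le (h : IsPartition T N t) (hx : IsArcDeriv T x w)
    {L : ℝ} (hL : 0 ≤ L)
    (hg : ∀ x₁ x₂ : RSpace n, ∀ v ∈ U, ‖g x₁ v - g x₂ v‖ ≤ L * ‖x₁ - x₂‖)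
    (hu : ∀ j < N, u (t j) ∈ U) {j : ℕ} (hj : j ≤ N) :
    ‖discreteState g t x w u j - x (t j)‖ ≤ Real.exp (L * t j) *
      ∫ s in (0 : ℝ)..t j, ‖stepFun N t (fun i => w (t i)) s - w s‖ := by
  induction j with
  | zero => simp [discreteState, h.left]
  | succ j ih =>
    have ih := ih (by omega)
    have hjN : j < N := hj
    have hN : 0 < N := by omega
    have hlt := h.lt j hjN
    have hpos := sub_pos.2 hlt
    have hp := h.mem_Icc hjN.le
    have hq := h.mem_Icc hj
    have h0 : (0 : ℝ) ∈ Icc 0 T := ⟨le_rfl, hp.1.trans hp.2⟩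
    obtain ⟨R, hR⟩ := exists_bound_stepFun (t := t) hN (fun i => w (t i))
    have hint : ∀ {p q : ℝ}, p ∈ Icc 0 T → q ∈ Icc 0 T → IntervalIntegrable
        (fun s => ‖stepFun N t (fun i => w (t i)) s - w s‖) volume p q := fun hp hq =>
      ((intervalIntegrable_of_bounded (stronglyMeasurable_stepFun _) hR _ _).sub
        (hx.intervalIntegrable hp hq)).norm
    set y := discreteState g t x w u j with hy
    set I := ∫ s in (0 : ℝ)..t j, ‖stepFun N t (fun i => w (t i)) s - w s‖ with hI
    set ε := ∫ s in (t j)..t (j + 1), ‖stepFun N t (fun i => w (t i)) s - w s‖ with hε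
    have hI0 : 0 ≤ I := intervalIntegral.integral_nonneg hp.1 fun _ _ => norm_nonneg _
    have hε0 : 0 ≤ ε := intervalIntegral.integral_nonneg hlt.le fun _ _ => norm_nonneg _
    have hsplit : ∫ s in (0 : ℝ)..t (j + 1), ‖stepFun N t (fun i => w (t i)) s - w s‖ = I + ε :=
      (intervalIntegral.integral_add_adjacent_intervals (hint h0 hp) (hint hp hq)).symm
    -- The new error is the old one, plus a Lipschitz term, plus the error of freezing `w` at the
    -- left end point.
    have hstep : discreteState g t x w u (j + 1) - x (t (j + 1)) =
        (y - x (t j)) + (t (j + 1) - t j) • (g y (u (t j)) - g (x (t j)) (u (t j))) +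
          ∫ s in (t j)..t (j + 1), (stepFun N t (fun i => w (t i)) s - w s) := by
      rw [intervalIntegral.integral_sub
        (intervalIntegrable_of_bounded (stronglyMeasurable_stepFun _) hR _ _)
        (hx.intervalIntegrable hp hq), hx.integral_eq hp hq,
        h.integral_stepFun hjN _ ⟨hlt.le, le_rfl⟩, discreteState, ← hy, smul_add]
      abel
    have h1 : ‖(t (j + 1) - t j) • (g y (u (t j)) - g (x (t j)) (u (t j)))‖ ≤
        (t (j + 1) - t j) * (L * ‖y - x (t j)‖) := by
      rw [norm_smul, Real.norm_of_nonneg hpos.le]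
      exact mul_le_mul_of_nonneg_left (hg _ _ _ (hu j hjN)) hpos.le
    have h2 : ‖∫ s in (t j)..t (j + 1), (stepFun N t (fun i => w (t i)) s - w s)‖ ≤ ε :=
      intervalIntegral.norm_integral_le_integral_norm hlt.le
    have h3 : 1 + L * (t (j + 1) - t j) ≤ Real.exp (L * (t (j + 1) - t j)) := by
      rw [add_comm]
      exact Real.add_one_le_exp _
    have h4 : Real.exp (L * t (j + 1)) =
        Real.exp (L * (t (j + 1) - t j)) * Real.exp (L * t j) := by
      rw [← Real.exp_add]
      congr 1
      ring
    have h5 : 1 ≤ Real.exp (L * t (j + 1)) := Real.one_le_exp (mul_nonneg hL hq.1)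
    rw [hstep, hsplit]
    calc _ ≤ ‖y - x (t j)‖ + (t (j + 1) - t j) * (L * ‖y - x (t j)‖) + ε :=
          (norm_add_le _ _).trans (add_le_add ((norm_add_le _ _).trans
            (add_le_add le_rfl h1)) h2)
      _ = (1 + L * (t (j + 1) - t j)) * ‖y - x (t j)‖ + ε := by ring
      _ ≤ Real.exp (L * (t (j + 1) - t j)) * (Real.exp (L * t j) * I) +
            Real.exp (L * t (j + 1)) * ε :=
          add_le_add (mul_le_mul h3 ih (norm_nonneg _) (Real.exp_pos _).le)
            (le_mul_of_one_le_left hε0 h5)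
      _ = Real.exp (L * t (j + 1)) * (I + ε) := by
          rw [h4]
          ring

end Sweeping

/-! ### Convergence of the discrete process. -/

section SweepingLimits

variable {n m d : ℕ} {T : ℝ} {N : ℕ → ℕ} {t : ℕ → ℕ → ℝ} {μ : ℕ → ℝ} {U : Set (RSpace d)}
  {g : RSpace n → RSpace d → RSpace n} {x w : ℝ → RSpace n} {u : ℝ → RSpace d}

theorem IsMeshSeq.exists_discreteState_bound (h : IsMeshSeq T N t μ) (hT : 0 ≤ T)
    (hx : IsArcDeriv T x w) (hw : IsRiemann T w) {L : ℝ} (hL : 0 ≤ L)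
    (hg : ∀ x₁ x₂ : RSpace n, ∀ v ∈ U, ‖g x₁ v - g x₂ v‖ ≤ L * ‖x₁ - x₂‖)
    (hu : ∀ k, ∀ j < N k, u (t k j) ∈ U) :
    ∃ η : ℕ → ℝ, Tendsto η atTop (𝓝 0) ∧
      ∀ k, ∀ j ≤ N k, ‖discreteState g (t k) x w u j - x (t k j)‖ ≤ η k := by
  obtain ⟨⟨R, hR⟩, hc⟩ := hw
  have hstep : ∀ k s, ‖stepFun (N k) (t k) (fun i => w (t k i)) s‖ ≤ R := fun k =>
    norm_stepFun_le (h.pos k) fun j hj => hR _ ((h.part k).mem_Icc hj.le)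
  -- The Gronwall bound is enlarged to the whole of `[0,T]` to make it independent of `j`.
  refine ⟨fun k => Real.exp (L * T) *
    ∫ s in (0 : ℝ)..T, ‖stepFun (N k) (t k) (fun i => w (t k i)) s - w s‖, ?_, ?_⟩
  · have h1 := tendsto_integral_norm_sub_of_dominated hT hx.1.1 hR
      (W := fun k => stepFun (N k) (t k) fun i => w (t k i))
      (fun k => stronglyMeasurable_stepFun _) hstep (by
        filter_upwards [hc, ae_restrict_mem measurableSet_Icc] with s hcs hs
        exact h.tendsto_stepFun hs hcs)
    simpa using h1.const_mul (Real.exp (L * T))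
  · intro k j hj
    have hm := (h.part k).mem_Icc hj
    refine ((h.part k).norm_discreteState_sub_le hx hL hg (hu k) hj).trans ?_
    refine mul_le_mul (Real.exp_le_exp.2 (mul_le_mul_of_nonneg_left hm.2 hL)) ?_
      (intervalIntegral.integral_nonneg hm.1 fun _ _ => norm_nonneg _) (Real.exp_pos _).le
    refine intervalIntegral.integral_mono_interval le_rfl hm.1 hm.2
      (Eventually.of_forall fun _ => norm_nonneg _) ?_
    exact ((intervalIntegrable_of_bounded (stronglyMeasurable_stepFun _) (hstep k) _ _).sub
      (hx.intervalIntegrable ⟨le_rfl, hT⟩ ⟨hT, le_rfl⟩)).norm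

/-- The discrete states, together with the translations of the polyhedra that they require,
converge in `W^{1,2}`. -/
theorem IsMeshSeq.tendstoW12_discreteState (h : IsMeshSeq T N t μ) (hT : 0 ≤ T)
    (hx : IsArcDeriv T x w) (hw : IsRiemann T w) {L : ℝ} (hL : 0 ≤ L)
    (hg : ∀ x₁ x₂ : RSpace n, ∀ v ∈ U, ‖g x₁ v - g x₂ v‖ ≤ L * ‖x₁ - x₂‖)
    (hu : ∀ k, ∀ j < N k, u (t k j) ∈ U)
    {a a' : ℝ → RFamily m n} (ha : IsArcDeriv T a a') (ha' : IsRiemann T a')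
    {b b' : ℝ → RSpace m} (hb : IsArcDeriv T b b') (hb' : IsRiemann T b') :
    TendstoW12 T (fun k => polygon (N k) (t k) (discreteState g (t k) x w u)) x ∧
    TendstoW12 T (fun k => polygon (N k) (t k) fun j => b (t k j) +
      rowPairing (a (t k j)) (discreteState g (t k) x w u j - x (t k j))) b := by
  obtain ⟨η, hη, hηe⟩ := h.exists_discreteState_bound hT hx hw hL hg hu
  obtain ⟨C, hC⟩ : ∃ C, ∀ k, η k ≤ C := by
    obtain ⟨C, hC⟩ := hη.bddAbove_range
    exact ⟨C, fun k => hC ⟨k, rfl⟩⟩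
  obtain ⟨⟨R, hR⟩, hwc⟩ := hw
  obtain ⟨⟨A, hA⟩, hac⟩ := ha'
  obtain ⟨⟨B, hB⟩, hbc⟩ := hb'
  have hanorm := ha.norm_le hT hA
  set K : ℝ := ‖a 0‖ + A * T with hK
  have hA0 : 0 ≤ A := (norm_nonneg _).trans (hA 0 ⟨le_rfl, hT⟩)
  have hK0 : 0 ≤ K := (norm_nonneg _).trans (hanorm 0 ⟨le_rfl, hT⟩)
  have hgk : ∀ k, ∀ j < N k, ‖g (discreteState g (t k) x w u j) (u (t k j)) -
      g (x (t k j)) (u (t k j))‖ ≤ L * η k := fun k j hj =>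
    (hg _ _ _ (hu k j hj)).trans (mul_le_mul_of_nonneg_left (hηe k j hj.le) hL)
  have hslope : ∀ k, ∀ j < N k, ‖meshSlope (t k) (discreteState g (t k) x w u) j‖ ≤
      L * C + R := by
    intro k j hj
    rw [(h.part k).meshSlope_discreteState hj]
    exact (norm_add_le _ _).trans (add_le_add ((hgk k j hj).trans
      (mul_le_mul_of_nonneg_left (hC k) hL)) (hR _ ((h.part k).mem_Icc hj.le)))
  have hslope_lim : ∀ s ∈ Icc 0 T, ContinuousWithinAt w (Icc 0 T) s → Tendsto
      (fun k => stepFun (N k) (t k) (meshSlope (t k) (discreteState g (t k) x w u)) s)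
      atTop (𝓝 (w s)) := by
    intro s hs hcs
    have h1 : Tendsto (fun k => g (discreteState g (t k) x w u (meshIndex (N k) (t k) s))
        (u (t k (meshIndex (N k) (t k) s))) - g (x (t k (meshIndex (N k) (t k) s)))
        (u (t k (meshIndex (N k) (t k) s)))) atTop (𝓝 0) := by
      refine squeeze_zero_norm (fun k => hgk k _ (meshIndex_lt (h.pos k) s)) ?_
      simpa using hη.const_mul L
    have h2 := h1.add (h.tendsto_stepFun hs hcs)
    rw [zero_add] at h2
    refine h2.congr fun k => ?_
    rw [stepFun, stepFun, (h.part k).meshSlope_discreteState (meshIndex_lt (h.pos k) s)]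
  have he_slope : ∀ k j, meshSlope (t k)
      (fun i => discreteState g (t k) x w u i - x (t k i)) j =
      meshSlope (t k) (discreteState g (t k) x w u) j - meshSlope (t k) (fun i => x (t k i)) j := by
    intro k j
    simp only [meshSlope, ← smul_sub]
    congr 1
    abel
  refine ⟨h.tendstoW12_polygon hT hx (fun k => rfl) hslope ?_,
    -- The bound `R` adds the three terms of the Leibniz rule: the slope of `b`, the size of `a`
    -- times the slope of the error, and the slope of `a` times the error.
    h.tendstoW12_polygon hT hb (fun k => ?_) (R := B + K * (L * C + R + R) + A * C) ?_ ?_⟩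
  · filter_upwards [hwc, ae_restrict_mem measurableSet_Icc] with s hcs hs
    exact hslope_lim s hs hcs
  · ext i
    simp [(h.part k).left, discreteState, rowPairing_apply]
  · intro k j hj
    rw [meshSlope_rowPairing]
    refine (norm_add_le _ _).trans (add_le_add ((norm_add_le _ _).trans (add_le_add ?_ ?_)) ?_)
    · exact (h.part k).norm_meshSlope_le hb hB hj
    · refine (norm_rowPairing_le _ _).trans (mul_le_mul (hanorm _ ((h.part k).mem_Icc hj)) ?_
        (norm_nonneg _) hK0)
      rw [he_slope]
      exact (norm_sub_le _ _).trans (add_le_add (hslope k j hj)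
        ((h.part k).norm_meshSlope_le hx hR hj))
    · exact (norm_rowPairing_le _ _).trans (mul_le_mul ((h.part k).norm_meshSlope_le ha hA hj)
        ((hηe k j hj.le).trans (hC k)) (norm_nonneg _) hA0)
  · filter_upwards [hwc, hbc, ae_restrict_mem measurableSet_Icc] with s hcw hcb hs
    have h1 : Tendsto (fun k => rowPairing (a (t k (meshIndex (N k) (t k) s + 1)))
        (meshSlope (t k) (fun i => discreteState g (t k) x w u i - x (t k i))
          (meshIndex (N k) (t k) s))) atTop (𝓝 0) := by
      have h2 := ((hslope_lim s hs hcw).sub (h.tendsto_meshSlope hx hs hcw)).norm.const_mul K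
      rw [sub_self, norm_zero, mul_zero] at h2
      refine squeeze_zero_norm (fun k => ?_) h2
      rw [he_slope]
      exact (norm_rowPairing_le _ _).trans (mul_le_mul_of_nonneg_right
        (hanorm _ ((h.part k).mem_Icc (meshIndex_lt (h.pos k) s))) (norm_nonneg _))
    have h3 : Tendsto (fun k => rowPairing
        (meshSlope (t k) (fun i => a (t k i)) (meshIndex (N k) (t k) s))
        (discreteState g (t k) x w u (meshIndex (N k) (t k) s) -
          x (t k (meshIndex (N k) (t k) s)))) atTop (𝓝 0) := by
      have h4 := hη.const_mul A
      rw [mul_zero] at h4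
      refine squeeze_zero_norm (fun k => ?_) h4
      have hj : meshIndex (N k) (t k) s < N k := meshIndex_lt (h.pos k) s
      exact (norm_rowPairing_le _ _).trans (mul_le_mul ((h.part k).norm_meshSlope_le ha hA hj)
        (hηe k _ hj.le) (norm_nonneg _) hA0)
    have h5 := ((h.tendsto_meshSlope hb hs hcb).add h1).add h3
    rw [add_zero, add_zero] at h5
    refine h5.congr fun k => ?_
    rw [stepFun, stepFun, meshSlope_rowPairing]

end SweepingLimits

theorem tendstoL2_congr_ae {E : Type*} [NormedAddCommGroup E] {T : ℝ} {F : ℕ → ℝ → E}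
    {f f' : ℝ → E} (h : TendstoL2 T F f) (hf : ∀ᵐ t ∂(timeMeasure T), f t = f' t) :
    TendstoL2 T F f' := by
  refine ⟨h.1, h.2.1.ae_eq hf, h.2.2.congr fun k => eLpNorm_congr_ae ?_⟩
  filter_upwards [hf] with t ht
  rw [ht]

end

/-! ### Choice of mesh and assembly. -/

theorem theorem4p1 {n m d : ℕ} (T : ℝ) (hT : 0 < T)
    (U : Set (RSpace d)) (g : RSpace n → RSpace d → RSpace n)
    (x₀ : RSpace n) (a₀ : RFamily m n) (b₀ : RSpace m)
    (x : ℝ → RSpace n) (a : ℝ → RFamily m n) (b : ℝ → RSpace m) (u : ℝ → RSpace d)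
    (hfeas : IsFeasible T U g x₀ a₀ b₀ x a b u)
    -- the standing assumptions
    (hU : IsClosed U ∧ Bornology.IsBounded U)
    (hab : BoundedDerivs T a b)
    (hg : RegularPerturbation U g)
    (hdom : DominatedIncrements T a)
    (hslater : UniformSlater T a b)
    -- bounded variation of the derivatives and of the control
    (hx_bv : HasBVDeriv T x) (ha_bv : HasBVDeriv T a) (hb_bv : HasBVDeriv T b)
    (hu_bv : ∃ w : ℝ → RSpace d, (∀ᵐ t ∂(timeMeasure T), u t = w t) ∧
      BoundedVariationOn w (Icc 0 T)) :
    ∃ (νt : ℝ) (ν : ℕ → ℕ) (τ : ℕ → ℕ → ℝ) (δ : ℕ → ℝ)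
      (xk : ℕ → ℝ → RSpace n) (ak : ℕ → ℝ → RFamily m n) (bk : ℕ → ℝ → RSpace m)
      (uk : ℕ → ℝ → RSpace d),
      -- the partitions
      0 < νt ∧
      (∀ k, k ≤ ν k ∧ IsPartition T (ν k) (τ k) ∧
        ∀ j < ν k, τ k (j + 1) - τ k j ≤ νt / (ν k : ℝ)) ∧
      -- the tolerances
      (∀ k, 0 < δ k) ∧ Tendsto δ atTop (𝓝 0) ∧
      -- the shape of the approximations and their initial data
      (∀ k, IsPiecewiseLinear (ν k) (τ k) (xk k) ∧ IsPiecewiseLinear (ν k) (τ k) (ak k) ∧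
        IsPiecewiseLinear (ν k) (τ k) (bk k) ∧ IsPiecewiseConstant (ν k) (τ k) (uk k)) ∧
      (∀ k, xk k 0 = x₀ ∧ ak k 0 = a₀ ∧ bk k 0 = b₀) ∧
      (∀ k, ∀ t ∈ Icc 0 T, uk k t ∈ U) ∧
      -- the relaxed norm constraints at the mesh points
      (∀ k, ∀ j ≤ ν k, ∀ i, 1 - δ k ≤ ‖ak k (τ k j) i‖ ∧ ‖ak k (τ k j) i‖ ≤ 1 + δ k) ∧
      -- the discrete sweeping inclusion
      (∀ k, ∀ j < ν k, ∃ v : RSpace n,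
        -v ∈ velocityMap g (xk k (τ k j)) (ak k (τ k j)) (bk k (τ k j)) (uk k (τ k j)) ∧
        ∀ t ∈ Icc (τ k j) (τ k (j + 1)), xk k t = xk k (τ k j) + (t - τ k j) • v) ∧
      -- strong convergence
      TendstoW12 T xk x ∧ TendstoW12 T ak a ∧ TendstoW12 T bk b ∧ TendstoL2 T uk u := by
  obtain ⟨⟨L, hL, hgL⟩, -⟩ := hg
  have hgx : ∀ x₁ x₂ : RSpace n, ∀ v ∈ U, ‖g x₁ v - g x₂ v‖ ≤ L * ‖x₁ - x₂‖ :=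
    fun x₁ x₂ v hv => by simpa using hgL x₁ x₂ v hv v hv
  obtain ⟨wx, hwx, hincl⟩ := hfeas.inclusion
  obtain ⟨vx, hvx, hvx_bv⟩ := hx_bv
  obtain ⟨va, hva, hva_bv⟩ := ha_bv
  obtain ⟨vb, hvb, hvb_bv⟩ := hb_bv
  obtain ⟨vu, hvu, hvu_bv⟩ := hu_bv
  obtain ⟨u₀, hu₀⟩ : ∃ u₀, u₀ ∈ U := by
    have hne : (ae (timeMeasure T)).NeBot := by
      rw [ae_neBot, timeMeasure, Ne, Measure.restrict_eq_zero, Real.volume_Icc,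
        ENNReal.ofReal_eq_zero]
      linarith
    obtain ⟨t, ht⟩ := hfeas.u_constraint.exists
    exact ⟨u t, ht⟩
  -- the values at the initial time are at our disposal
  set w := Function.update vx 0 (g x₀ u₀) with hw
  set ω := Function.update vu 0 u₀ with hω
  have hw_ae : ∀ᵐ t ∂(timeMeasure T), vx t = w t := by
    filter_upwards [ae_ne_zero T] with t ht
    rw [hw, Function.update_of_ne ht]
  have hω_ae : ∀ᵐ t ∂(timeMeasure T), ω t = u t := by
    filter_upwards [ae_ne_zero T, hvu] with t ht hut
    rw [hω, Function.update_of_ne ht, hut]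
  have hxw : IsArcDeriv T x w := hvx.congr_ae hw_ae
  have hw_R : IsRiemann T w := (hvx_bv.isRiemann hT.le).update _
  have hω_R : IsRiemann T ω := (hvu_bv.isRiemann hT.le).update _
  set G : Set ℝ := {t | -w t ∈ velocityMap g (x t) (a t) (b t) (ω t) ∧ ω t ∈ U} with hG
  have hG_ae : ∀ᵐ t ∂(timeMeasure T), t ∈ G := by
    filter_upwards [hincl, hfeas.u_constraint, hω_ae, hwx.ae_eq hT hxw] with t h1 h2 h3 h4
    rw [hG, mem_ofPred_eq, h3, ← h4]
    exact ⟨h1, h2⟩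
  -- With the prescribed values at time `0`, the normal vector `g(x₀,u₀) - w(0)` vanishes, and zero
  -- is normal at any feasible point.
  have hG0 : (0 : ℝ) ∈ G := by
    have h1 := neg_perturbation_mem_velocityMap (g := g) (u := u₀)
      (hfeas.state_constraint 0 ⟨le_rfl, hT.le⟩)
    rw [hfeas.x_init] at h1
    rw [hG, mem_ofPred_eq, hw, hω, Function.update_self, Function.update_self, hfeas.x_init]
    exact ⟨h1, hu₀⟩
  choose τ hτ hτG hτsize using fun k : ℕ => exists_partition hT hG_ae hG0 (Nat.succ_pos k)
  have hmesh : IsMeshSeq T (fun k => k.succ) τ (fun k => 2 * T / (k.succ : ℕ)) := by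
    refine ⟨fun k => Nat.succ_pos k, hτ, hτsize, ?_⟩
    exact (tendsto_const_div_atTop_nhds_zero_nat (2 * T)).comp (tendsto_add_atTop_nat 1)
  have hωU : ∀ k, ∀ j < Nat.succ k, ω (τ k j) ∈ U := fun k j hj => (hτG k j hj).2
  obtain ⟨hxlim, hblim⟩ := hmesh.tendstoW12_discreteState hT.le hxw hw_R hL.le hgx hωU hva
    (hva_bv.isRiemann hT.le) hvb (hvb_bv.isRiemann hT.le)
  -- Using `k + 1` intervals avoids an empty mesh at `k = 0`. Any positive null sequence serves as
  -- `δ`, since `aᵏ` agrees with `a` at the mesh points and its rows have norm exactly one there.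
  refine ⟨2 * T, fun k => k.succ, τ, fun k => 1 / ((k : ℝ) + 1),
    fun k => polygon k.succ (τ k) (discreteState g (τ k) x w ω),
    fun k => polygon k.succ (τ k) fun j => a (τ k j),
    fun k => polygon k.succ (τ k) fun j => b (τ k j) +
      rowPairing (a (τ k j)) (discreteState g (τ k) x w ω j - x (τ k j)),
    fun k => stepFun k.succ (τ k) fun j => ω (τ k j),
    by linarith, fun k => ⟨Nat.le_succ k, hτ k, hτsize k⟩, fun k => by positivity,
    tendsto_one_div_add_atTop_nhds_zero_nat,
    fun k => ⟨(hτ k).isPiecewiseLinear_polygon _, (hτ k).isPiecewiseLinear_polygon _,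
      (hτ k).isPiecewiseLinear_polygon _, (hτ k).isPiecewiseConstant_stepFun _⟩,
    fun k => ?_, fun k t _ => hωU k _ (meshIndex_lt (Nat.succ_pos k) t), fun k j hj i => ?_,
    fun k j hj => ?_, hxlim, hmesh.tendstoW12_interpolant hT.le hva (hva_bv.isRiemann hT.le),
    hblim, tendstoL2_congr_ae (hmesh.tendstoL2_stepFun hω_R) hω_ae⟩
  · simp only [polygon_zero]
    refine ⟨hfeas.x_init, by rw [(hτ k).left, hfeas.a_init], ?_⟩
    ext i
    simp [(hτ k).left, discreteState, rowPairing_apply, hfeas.b_init]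
  · have hpos : 0 < 1 / ((k : ℝ) + 1) := by positivity
    beta_reduce
    rw [(hτ k).polygon_mesh _ hj, hfeas.a_norm _ ((hτ k).mem_Icc hj) i]
    constructor <;> linarith
  · refine ⟨meshSlope (τ k) (discreteState g (τ k) x w ω) j, ?_,
      fun s hs => (hτ k).polygon_eq _ hj hs⟩
    beta_reduce at hj ⊢
    rw [(hτ k).polygon_mesh _ hj.le, (hτ k).polygon_mesh _ hj.le, (hτ k).polygon_mesh _ hj.le,
      stepFun, (hτ k).meshIndex_eq hj ⟨le_rfl, (hτ k).lt j hj⟩,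
      (hτ k).meshSlope_discreteState hj]
    exact velocityMap_translate (hτG k j hj).1 _
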